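/- **Lemma 4.5.** Let $\psi:\mathbb R\to\mathbb C$ be continuous and consider on $\mathbb R$ the linear system $$\boldsymbol f'(x)=V(x,\lambda)\boldsymbol f(x),\qquad V(x,\lambda)=\begin{pmatrix}-\tfrac{i\lambda}{2}&\overline{\psi(x)}\\ \psi(x)&\tfrac{i\lambda}{2}\end{pmatrix},\qquad \boldsymbol f=\begin{pmatrix}f_1\\ f_2\end{pmatrix}.$$ Let $\Gamma=\{Q=(\lambda,\pm):\lambda=\lambda(Q)\in\mathbb C\setminus\mathbb R\}$, and let $\Gamma_R\subset\Gamma$ consist of the points $(\lambda,+)$ with $\operatorname{Im}\lambda>0$ and $(\lambda,-)$ with $\operatorname{Im}\lambda<0$, and $\Gamma_L=\Gamma\setminus\Gamma_R$. For $z\in\mathbb R$ and $Q\in\Gamma$ the Weyl solution $\boldsymbol e(x,z,Q)=(e_1,e_2)^T$ is the solution $x\mapsto \boldsymbol e(x,z,Q)$ of the system with $\lambda=\lambda(Q)$ which is square integrable on $[z,+\infty)$ if $Q\in\Gamma_R$, and on $(-\infty,z]$ if $Q\in\Gamma_L$, normalized by $e_1(z,z,Q)=1$; the Weyl function is $\mathcal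 X(z,Q)=e_2(z,z,Q)$, that is, $\boldsymbol e=M^{(1)}+\mathcal X(z,Q)M^{(2)}$ with $M^{(1)},M^{(2)}$ the solutions equal to $(1,0)^T,(0,1)^T$ at $x=z$. One puts $\mathcal X(z,Q)=\infty$ if a nontrivial solution that is square integrable on that half-line has vanishing first component at $z$. For a functional $F$ of the potential, $\frac{\delta F}{\delta\psi(y)}=G(y)$ and $\frac{\delta F}{\delta\overline\psi(y)}=H(y)$ mean that $G,H\in L^1(\mathbb R)$ and that $h\mapsto F(\psi+h)$, on the bounded continuous functions $h:\mathbb R\to\mathbb C$ with the sup norm, is (real) Fréchet differentiable at $h=0$ with derivative $h\mapsto\int_{\mathbb R}\bigl(G(y)h(y)+H(y)\overline{h(y)}\bigr)\,dy$. (This determines $G$ and $H$ up to null sets.) Fix $z\in\mathbb R$ and $Q\in\Gamma$ with $\mathcal X(z,Q)\neq\infty$. Then for all bounded continuous $h$ with sufficiently small sup norm the Weyl solution for the potential $\psi+h$ exists and is unique, and the following holds. If $Q\in\Gamma_R$, then $$\frac{\delta\mathcal X(z,Q)}{\delta\psi(y)}=-\bigl[e_1(y,z,Q)\bigr]^2,\qquad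 \frac{\delta\mathcal X(z,Q)}{\delta\overline\psi(y)}=\bigl[e_2(y,z,Q)\bigr]^2\qquad(y\ge z),$$ and both derivatives vanish for $y<z$. If $Q\in\Gamma_L$, then $$\frac{\delta\mathcal X(z,Q)}{\delta\psi(y)}=\bigl[e_1(y,z,Q)\bigr]^2,\qquad \frac{\delta\mathcal X(z,Q)}{\delta\overline\psi(y)}=-\bigl[e_2(y,z,Q)\bigr]^2\qquad(y\le z),$$ and both derivatives vanish for $y>z$. -/

import Mathlib

open MeasureTheory Filter Topology Set
open scoped BoundedContinuousFunction Matrix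

namespace DiracWeyl

/-- The coefficient matrix `V(x, lam)` of the auxiliary linear problem with potential `ψ`. -/
noncomputable def V (ψ : C(ℝ, ℂ)) (lam : ℂ) (x : ℝ) : Matrix (Fin 2) (Fin 2) ℂ :=
  !![-(Complex.I * lam / 2), (starRingEnd ℂ) (ψ x); ψ x, Complex.I * lam / 2]

/-- `f` solves the auxiliary linear problem `f' = V f` on the whole line. -/
def IsSolution (ψ : C(ℝ, ℂ)) (lam : ℂ) (f : ℝ → Fin 2 → ℂ) : Prop :=
  ∀ x : ℝ, HasDerivAt f (V ψ lam x *ᵥ f x) x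

/-- `f* f` is integrable over the set `s`. -/
def SquareIntegrableOn (f : ℝ → Fin 2 → ℂ) (s : Set ℝ) : Prop :=
  IntegrableOn (fun x => ‖f x 0‖ ^ 2 + ‖f x 1‖ ^ 2) s volume

/-- The two sheets of the spectral cover. -/
inductive Sheet : Type
  | plus : Sheet
  | minus : Sheet

/-- The spectral cover: pairs of a non-real spectral parameter and a sheet. -/
structure Cover : Type where
  lam : ℂ
  sheet : Sheet
  im_ne_zero : lam.im ≠ 0

/-- The component `Γ_R` of the spectral cover. -/
def GammaR : Set Cover :=
  {Q | (Q.sheet = Sheet.plus ∧ 0 < Q.lam.im) ∨ (Q.sheet = Sheet.minus ∧ Q.lam.im < 0)}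

/-- The component `Γ_L` of the spectral cover. -/
def GammaL : Set Cover :=
  {Q | (Q.sheet = Sheet.plus ∧ Q.lam.im < 0) ∨ (Q.sheet = Sheet.minus ∧ 0 < Q.lam.im)}

/-- `f` solves the problem with `lam = lam(Q)`, and is square integrable on `[y, ∞)` if `Q ∈ Γ_R`,
on `(-∞, y]` if `Q ∈ Γ_L`. No normalization is imposed. -/
def IsL2Solution (ψ : C(ℝ, ℂ)) (y : ℝ) (Q : Cover) (f : ℝ → Fin 2 → ℂ) : Prop :=
  IsSolution ψ Q.lam f ∧
    (Q ∈ GammaR → SquareIntegrableOn f (Ici y)) ∧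
    (Q ∈ GammaL → SquareIntegrableOn f (Iic y))

/-- `f` is the Weyl solution with base point `y`: the square integrable solution normalized by
`f₁(y) = 1`. -/
def IsWeylSolution (ψ : C(ℝ, ℂ)) (y : ℝ) (Q : Cover) (f : ℝ → Fin 2 → ℂ) : Prop :=
  IsL2Solution ψ y Q f ∧ f y 0 = 1

/-- `𝒳(y, Q) ≠ ∞`: no nontrivial square integrable solution has a vanishing first component
at `y`. (Only then can a square integrable solution be normalized by `f₁(y) = 1`.) -/
def WeylFinite (ψ : C(ℝ, ℂ)) (y : ℝ) (Q : Cover) : Prop :=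
  ∀ f : ℝ → Fin 2 → ℂ, IsL2Solution ψ y Q f → f ≠ 0 → f y 0 ≠ 0

open Classical in
/-- The Weyl solution `e(x, y, Q)`; it is set to zero where no normalized solution exists. -/
noncomputable def weylSolution (ψ : C(ℝ, ℂ)) (x y : ℝ) (Q : Cover) : Fin 2 → ℂ :=
  if h : ∃ f : ℝ → Fin 2 → ℂ, IsWeylSolution ψ y Q f then h.choose x else 0

/-- The Weyl function `𝒳(y, Q)`, the coefficient in
`e(x, y, Q) = M⁽¹⁾(x, y, lam) + 𝒳(y, Q) M⁽²⁾(x, y, lam)`. Here `M⁽¹⁾, M⁽²⁾` are the columns of the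
fundamental matrix that is the identity at `x = y`, so that `e(y, y, Q) = (1, 𝒳(y, Q))`. -/
noncomputable def weylFunction (ψ : C(ℝ, ℂ)) (y : ℝ) (Q : Cover) : ℂ :=
  weylSolution ψ y y Q 1

/-- The functional `F` of the potential has at `ψ` the functional gradients
`δF/δψ = G` and `δF/δψ̄ = H`: the map `h ↦ F (ψ + h)` on bounded continuous variations `h`, with
the sup norm, is Fréchet differentiable at `0` (over the reals), with derivative
`h ↦ ∫ (G h + H h̄)`. The integrable functions `G` and `H` are unique up to null sets, because
`h` and `i h` are both allowed. -/
def HasFunctionalGradients (F : C(ℝ, ℂ) → ℂ) (ψ : C(ℝ, ℂ)) (G H : ℝ → ℂ) : Prop :=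
  Integrable G volume ∧ Integrable H volume ∧
    ∃ L : (ℝ →ᵇ ℂ) →L[ℝ] ℂ,
      (∀ h : ℝ →ᵇ ℂ, L h = ∫ y, (G y * h y + H y * (starRingEnd ℂ) (h y))) ∧
      HasFDerivAt (fun h : ℝ →ᵇ ℂ => F (ψ + h.toContinuousMap)) L 0

end DiracWeyl

/-! Let `S` be the half-line of `Q`, and `e`, `g` the Weyl solutions for `ψ` and `ψ + h`. In the
derivative of their Wronskian only terms with `h` survive, and square integrability kills the
boundary term at infinity. Hence the increment of the Weyl function is exactly `∓∫_S (h e₁ g₁ - h̄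
e₂ g₂)` (`wronskian_eq_integral`). Putting `e` for `g` gives the asserted derivative; by
Cauchy-Schwarz the error is at most `‖h‖ ‖e‖ ‖g - e‖` with `L²(S)` norms, so it remains to see that
`g → e` in `L²(S)`.

This follows from the indefinite form `|f₁|² - |f₂|²`, whose derivative along a solution is `Im λ`
times `|f|²`. For `g - e` it bounds `|Im λ| ‖g - e‖²` by a boundary value at `z`, which the
Wronskian formula controls, plus a source term of order `‖h‖`. For small `h` the terms containing `g
- e` are absorbed and `‖g - e‖² = O(‖h‖)` is left (`energy_sub_le_of_small`). The same two
identities keep the Weyl function finite under perturbation (`eq_zero_of_apply_zero_eq_zero`).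
Existence of square integrable solutions, for any continuous potential, is Weyl's compactness
argument with the same form (`exists_isSolution_integral_le`). -/

/-! ### Global existence for linearly bounded equations -/

/-- Global existence for a differential equation whose right-hand side is Lipschitz in the unknown,
with a constant that depends continuously on time. -/
theorem exists_global_solution {E : Type*} [NormedAddCommGroup E] [NormedSpace ℝ E]
    [CompleteSpace E] {F : ℝ → E → E} {k : ℝ → ℝ} (hF : Continuous fun p : ℝ × E => F p.1 p.2)
    (hk : Continuous k) (hk0 : ∀ t, 0 ≤ k t)
    (hFk : ∀ t u v, ‖F t u - F t v‖ ≤ k t * ‖u - v‖) (hF0 : ∀ t, F t 0 = 0) (z : ℝ) (v : E) :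
    ∃ f : ℝ → E, f z = v ∧ ∀ x, HasDerivAt f (F x (f x)) x := by
  set φ : ℝ → ℝ := fun x => ∫ t in z..x, k t with hφdef
  have hφ : ∀ x, HasDerivAt φ (k x) x := fun x =>
    intervalIntegral.integral_hasDerivAt_right (hk.intervalIntegrable _ _)
      (hk.stronglyMeasurableAtFilter _ _) hk.continuousAt
  have hφc : Continuous φ := continuous_iff_continuousAt.2 fun x => (hφ x).continuousAt
  -- A weighted sup norm makes the Picard operator contract on the whole line at once: `k * w`
  -- integrates to `sinh (2φ) / 2`, at most `w / 2` in absolute value. As `cosh` is even, one weight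
  -- serves both sides of `z`.
  set w : ℝ → ℝ := fun x => Real.cosh (2 * φ x) with hwdef
  have hwc : Continuous w := by fun_prop
  have hw1 : ∀ x, 1 ≤ w x := fun x => Real.one_le_cosh _
  have hw0 : ∀ x, 0 < w x := fun x => one_pos.trans_le (hw1 x)
  have hint : ∀ x, ∫ t in z..x, k t * w t = Real.sinh (2 * φ x) / 2 := by
    intro x
    have h : ∀ t, HasDerivAt (fun t => Real.sinh (2 * φ t) / 2) (k t * w t) t := fun t =>
      ((((hφ t).const_mul 2).sinh).div_const 2).congr_deriv (by simp only [w]; ring)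
    rw [intervalIntegral.integral_eq_sub_of_hasDerivAt (fun t _ => h t)
      ((hk.mul hwc).intervalIntegrable _ _)]
    simp [hφdef]
  have key : ∀ (u : ℝ → E) (C : ℝ), (∀ t, ‖u t‖ ≤ k t * w t * C) → 0 ≤ C → ∀ x,
      ‖∫ t in z..x, u t‖ ≤ w x * (C / 2) := by
    intro u C hu hC x
    have h1 := intervalIntegral.norm_integral_le_abs_of_norm_le (μ := volume) (a := z) (b := x)
      (Eventually.of_forall hu) (((hk.mul hwc).mul continuous_const).intervalIntegrable _ _)
    refine h1.trans ?_
    rw [intervalIntegral.integral_mul_const, hint, abs_mul, abs_of_nonneg hC, abs_div, abs_two]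
    have h2 : |Real.sinh (2 * φ x)| ≤ w x := by
      have := Real.cosh_sq (2 * φ x)
      refine abs_le_of_sq_le_sq ?_ (hw0 x).le
      simp only [hwdef]; linarith
    nlinarith
  have hgc : ∀ g : ℝ →ᵇ E, Continuous fun t => F t (w t • g t) := fun g =>
    hF.comp (continuous_id.prodMk (hwc.smul g.continuous))
  have hIc : ∀ g : ℝ →ᵇ E, ∀ x, HasDerivAt (fun x => v + ∫ t in z..x, F t (w t • g t))
      (F x (w x • g x)) x := fun g x =>
    (intervalIntegral.integral_hasDerivAt_right ((hgc g).intervalIntegrable _ _)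
      ((hgc g).stronglyMeasurableAtFilter _ _) (hgc g).continuousAt).const_add v
  have hwi : ∀ x, (w x)⁻¹ ≤ 1 := fun x => inv_le_one_of_one_le₀ (hw1 x)
  -- The Picard operator conjugated by `w`: a fixed point `g` yields the solution `w • g`.
  let T : (ℝ →ᵇ E) → (ℝ →ᵇ E) := fun g =>
    BoundedContinuousFunction.ofNormedAddCommGroup
      (fun x => (w x)⁻¹ • (v + ∫ t in z..x, F t (w t • g t)))
      ((hwc.inv₀ fun x => (hw0 x).ne').smul
        (continuous_iff_continuousAt.2 fun x => (hIc g x).continuousAt))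
      (‖v‖ + ‖g‖ / 2) (by
        intro x
        have h1 := key (fun t => F t (w t • g t)) ‖g‖ (fun t => by
          have := hFk t (w t • g t) 0
          rw [hF0, sub_zero, sub_zero, norm_smul, Real.norm_of_nonneg (hw0 t).le] at this
          refine this.trans ?_
          rw [mul_assoc]
          exact mul_le_mul_of_nonneg_left
            (mul_le_mul_of_nonneg_left (g.norm_coe_le_norm t) (hw0 t).le) (hk0 t))
          (norm_nonneg _) x
        rw [norm_smul, Real.norm_of_nonneg (inv_pos.2 (hw0 x)).le]
        calc (w x)⁻¹ * ‖v + ∫ t in z..x, F t (w t • g t)‖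
            ≤ (w x)⁻¹ * (‖v‖ + w x * (‖g‖ / 2)) :=
              mul_le_mul_of_nonneg_left ((norm_add_le _ _).trans (by gcongr))
                (inv_pos.2 (hw0 x)).le
          _ = (w x)⁻¹ * ‖v‖ + ‖g‖ / 2 := by
              rw [mul_add, inv_mul_cancel_left₀ (hw0 x).ne']
          _ ≤ ‖v‖ + ‖g‖ / 2 := by
              gcongr
              exact mul_le_of_le_one_left (norm_nonneg _) (hwi x))
  have hT : ContractingWith (1 / 2) T := by
    refine ⟨by rw [← NNReal.coe_lt_coe]; norm_num, LipschitzWith.of_dist_le_mul fun g g' => ?_⟩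
    rw [BoundedContinuousFunction.dist_le (by positivity)]
    intro x
    have h1 := key (fun t => F t (w t • g t) - F t (w t • g' t)) (dist g g') (fun t => by
      refine (hFk t _ _).trans ?_
      rw [← smul_sub, norm_smul, Real.norm_of_nonneg (hw0 t).le, mul_assoc, ← dist_eq_norm]
      exact mul_le_mul_of_nonneg_left (mul_le_mul_of_nonneg_left
        (BoundedContinuousFunction.dist_coe_le_dist t) (hw0 t).le) (hk0 t)) dist_nonneg x
    rw [intervalIntegral.integral_sub ((hgc g).intervalIntegrable _ _)
      ((hgc g').intervalIntegrable _ _)] at h1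
    have h2 : dist (T g x) (T g' x) = (w x)⁻¹ *
        ‖(∫ t in z..x, F t (w t • g t)) - ∫ t in z..x, F t (w t • g' t)‖ := by
      rw [dist_eq_norm]
      change ‖(w x)⁻¹ • (v + _) - (w x)⁻¹ • (v + _)‖ = _
      rw [← smul_sub, norm_smul, add_sub_add_left_eq_sub,
        Real.norm_of_nonneg (inv_pos.2 (hw0 x)).le]
    rw [h2]
    calc _ ≤ (w x)⁻¹ * (w x * (dist g g' / 2)) :=
          mul_le_mul_of_nonneg_left h1 (inv_pos.2 (hw0 x)).le
      _ = dist g g' / 2 := inv_mul_cancel_left₀ (hw0 x).ne' _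
      _ = _ := by push_cast; ring
  set g := ContractingWith.fixedPoint T hT with hg
  have hfix : T g = g := ContractingWith.fixedPoint_isFixedPt hT
  have hwg : ∀ x, w x • g x = v + ∫ t in z..x, F t (w t • g t) := fun x => by
    have : g x = (w x)⁻¹ • (v + ∫ t in z..x, F t (w t • g t)) :=
      congrArg (fun u : ℝ →ᵇ E => u x) hfix.symm
    conv_lhs => rw [this]
    rw [smul_inv_smul₀ (hw0 x).ne']
  refine ⟨fun x => w x • g x, (hwg z).trans (by simp), fun x => ?_⟩
  have h := hIc g x
  have heq : (fun x => v + ∫ t in z..x, F t (w t • g t)) = fun x => w x • g x :=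
    funext fun x => (hwg x).symm
  rwa [heq] at h

/-! ### The linear system: Wronskian, indefinite form, uniqueness -/

namespace DiracWeyl

theorem V_mulVec_zero (ψ : C(ℝ, ℂ)) (lam : ℂ) (x : ℝ) (u : Fin 2 → ℂ) :
    (V ψ lam x *ᵥ u) 0 = -(Complex.I * lam / 2) * u 0 + (starRingEnd ℂ) (ψ x) * u 1 := by
  simp [V, Matrix.mulVec, dotProduct, Fin.sum_univ_two]

theorem V_mulVec_one (ψ : C(ℝ, ℂ)) (lam : ℂ) (x : ℝ) (u : Fin 2 → ℂ) :
    (V ψ lam x *ᵥ u) 1 = ψ x * u 0 + Complex.I * lam / 2 * u 1 := by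
  simp [V, Matrix.mulVec, dotProduct, Fin.sum_univ_two]

theorem continuous_V (ψ : C(ℝ, ℂ)) (lam : ℂ) : Continuous (V ψ lam) := by
  refine continuous_matrix fun i j => ?_
  have h1 : Continuous fun x => (starRingEnd ℂ) (ψ x) :=
    Complex.continuous_conj.comp ψ.continuous
  fin_cases i <;> fin_cases j
  exacts [continuous_const, h1, ψ.continuous, continuous_const]

theorem norm_V_mulVec_le (ψ : C(ℝ, ℂ)) (lam : ℂ) (x : ℝ) (u : Fin 2 → ℂ) :
    ‖V ψ lam x *ᵥ u‖ ≤ (‖lam‖ / 2 + ‖ψ x‖) * ‖u‖ := by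
  have hI : ‖Complex.I * lam / 2‖ = ‖lam‖ / 2 := by simp
  rw [pi_norm_le_iff_of_nonneg (by positivity), Fin.forall_fin_two, V_mulVec_zero, V_mulVec_one]
  constructor
  · refine (norm_add_le _ _).trans ?_
    rw [norm_mul, norm_mul, norm_neg, hI, RCLike.norm_conj, add_mul]
    gcongr <;> exact norm_le_pi_norm u _
  · refine (norm_add_le _ _).trans ?_
    rw [norm_mul, norm_mul, hI, add_mul, add_comm]
    gcongr <;> exact norm_le_pi_norm u _

theorem exists_isSolution (ψ : C(ℝ, ℂ)) (lam : ℂ) (z : ℝ) (v : Fin 2 → ℂ) :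
    ∃ f, IsSolution ψ lam f ∧ f z = v := by
  obtain ⟨f, hz, hf⟩ := exists_global_solution (F := fun x u => V ψ lam x *ᵥ u)
    (k := fun x => ‖lam‖ / 2 + ‖ψ x‖)
    (((continuous_V ψ lam).comp continuous_fst).matrix_mulVec continuous_snd)
    (by fun_prop) (fun t => by positivity)
    (fun t u v => by rw [← Matrix.mulVec_sub]; exact norm_V_mulVec_le ψ lam t _)
    (fun t => Matrix.mulVec_zero _) z v
  exact ⟨f, hf, hz⟩

namespace IsSolution

variable {ψ : C(ℝ, ℂ)} {lam : ℂ} {f g : ℝ → Fin 2 → ℂ}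

theorem continuous (hf : IsSolution ψ lam f) : Continuous f :=
  continuous_iff_continuousAt.2 fun x => (hf x).continuousAt

theorem hasDerivAt_zero (hf : IsSolution ψ lam f) (x : ℝ) :
    HasDerivAt (fun x => f x 0)
      (-(Complex.I * lam / 2) * f x 0 + (starRingEnd ℂ) (ψ x) * f x 1) x := by
  rw [← V_mulVec_zero]; exact hasDerivAt_pi.1 (hf x) 0

theorem hasDerivAt_one (hf : IsSolution ψ lam f) (x : ℝ) :
    HasDerivAt (fun x => f x 1) (ψ x * f x 0 + Complex.I * lam / 2 * f x 1) x := by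
  rw [← V_mulVec_one]; exact hasDerivAt_pi.1 (hf x) 1

theorem add (hf : IsSolution ψ lam f) (hg : IsSolution ψ lam g) :
    IsSolution ψ lam (fun x => f x + g x) := fun x => by
  rw [Matrix.mulVec_add]; exact (hf x).add (hg x)

theorem const_smul (c : ℂ) (hf : IsSolution ψ lam f) : IsSolution ψ lam (fun x => c • f x) :=
  fun x => by rw [Matrix.mulVec_smul]; exact (hf x).const_smul c

theorem sub (hf : IsSolution ψ lam f) (hg : IsSolution ψ lam g) :
    IsSolution ψ lam (fun x => f x - g x) := fun x => by
  rw [Matrix.mulVec_sub]; exact (hf x).sub (hg x)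

theorem zero (ψ : C(ℝ, ℂ)) (lam : ℂ) : IsSolution ψ lam (fun _ => 0) := fun x => by
  rw [Matrix.mulVec_zero]; exact hasDerivAt_const x 0

end IsSolution

/-- The derivative of the Wronskian of solutions for two different potentials. -/
theorem hasDerivAt_wronskian {ψ φ : C(ℝ, ℂ)} {lam : ℂ} {f g : ℝ → Fin 2 → ℂ}
    (hf : IsSolution ψ lam f) (hg : IsSolution φ lam g) (x : ℝ) :
    HasDerivAt (fun x => f x 0 * g x 1 - f x 1 * g x 0)
      ((φ x - ψ x) * (f x 0 * g x 0) - (starRingEnd ℂ) (φ x - ψ x) * (f x 1 * g x 1)) x := by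
  refine (((hf.hasDerivAt_zero x).mul (hg.hasDerivAt_one x)).sub
    ((hf.hasDerivAt_one x).mul (hg.hasDerivAt_zero x))).congr_deriv ?_
  rw [map_sub]; ring

/-- The derivative of the indefinite form of the difference of solutions for two potentials. -/
theorem hasDerivAt_form_sub {ψ φ : C(ℝ, ℂ)} {lam : ℂ} {f g : ℝ → Fin 2 → ℂ}
    (hf : IsSolution ψ lam f) (hg : IsSolution φ lam g) (x : ℝ) :
    HasDerivAt (fun x => ‖g x 0 - f x 0‖ ^ 2 - ‖g x 1 - f x 1‖ ^ 2)
      (lam.im * (‖g x 0 - f x 0‖ ^ 2 + ‖g x 1 - f x 1‖ ^ 2) +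
        2 * ((starRingEnd ℂ) (g x 0 - f x 0) * ((starRingEnd ℂ) (φ x - ψ x) * f x 1) -
          (starRingEnd ℂ) (g x 1 - f x 1) * ((φ x - ψ x) * f x 0)).re) x := by
  have h0 := ((hg.hasDerivAt_zero x).sub (hf.hasDerivAt_zero x)).norm_sq
  have h1 := ((hg.hasDerivAt_one x).sub (hf.hasDerivAt_one x)).norm_sq
  refine (h0.sub h1).congr_deriv ?_
  simp only [Complex.inner, Complex.sq_norm, Complex.normSq_apply, Complex.mul_re, Complex.mul_im,
    Complex.add_re, Complex.add_im, Complex.sub_re, Complex.sub_im, Complex.neg_re, Complex.neg_im,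
    Complex.conj_re, Complex.conj_im, Complex.I_re, Complex.I_im, Complex.div_ofNat_re,
    Complex.div_ofNat_im, Pi.sub_apply]
  ring

theorem hasDerivAt_form {ψ : C(ℝ, ℂ)} {lam : ℂ} {f : ℝ → Fin 2 → ℂ}
    (hf : IsSolution ψ lam f) (x : ℝ) :
    HasDerivAt (fun x => ‖f x 0‖ ^ 2 - ‖f x 1‖ ^ 2)
      (lam.im * (‖f x 0‖ ^ 2 + ‖f x 1‖ ^ 2)) x := by
  simpa using hasDerivAt_form_sub (IsSolution.zero ψ lam) hf x

/-- Wronskians for a single potential are constant. Those of `f` with a fundamental system `m`, `n`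
vanish at `z`, that of `m` and `n` is 1, and the linear relation between three vectors in `ℂ²` then
gives `f = 0`. -/
theorem IsSolution.eq_zero {ψ : C(ℝ, ℂ)} {lam : ℂ} {f : ℝ → Fin 2 → ℂ}
    (hf : IsSolution ψ lam f) {z : ℝ} (hz : f z = 0) : f = 0 := by
  have hconst : ∀ p q : ℝ → Fin 2 → ℂ, IsSolution ψ lam p → IsSolution ψ lam q → ∀ x,
      p x 0 * q x 1 - p x 1 * q x 0 = p z 0 * q z 1 - p z 1 * q z 0 := fun p q hp hq x =>
    is_const_of_deriv_eq_zero (f := fun x => p x 0 * q x 1 - p x 1 * q x 0)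
      (fun x => (hasDerivAt_wronskian hp hq x).differentiableAt)
      (fun x => by simpa using (hasDerivAt_wronskian hp hq x).deriv) x z
  obtain ⟨m, hm, hmz⟩ := exists_isSolution ψ lam z ![1, 0]
  obtain ⟨n, hn, hnz⟩ := exists_isSolution ψ lam z ![0, 1]
  funext x
  have h1 := hconst f m hf hm x
  have h2 := hconst f n hf hn x
  have h3 := hconst m n hm hn x
  simp only [hz, hmz, hnz, Pi.zero_apply, sub_zero, Matrix.cons_val_zero,
    Matrix.cons_val_one, mul_one, mul_zero] at h1 h2 h3
  ext i
  fin_cases i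
  · simp only [Fin.zero_eta, Pi.zero_apply]
    linear_combination (-f x 0) * h3 + n x 0 * (-h1) + m x 0 * h2
  · simp only [Fin.mk_one, Pi.zero_apply]
    linear_combination (-f x 1) * h3 + n x 1 * (-h1) + m x 1 * h2

/-! ### Existence of square integrable solutions -/

/-- In both directions there is a nontrivial solution with bounded energy on bounded intervals. -/
theorem exists_isSolution_integral_le (ψ : C(ℝ, ℂ)) {lam : ℂ} (hlam : lam.im ≠ 0) (z s : ℝ)
    (hs : s = 1 ∨ s = -1) :
    ∃ f, IsSolution ψ lam f ∧ f ≠ 0 ∧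
      ∀ n : ℕ, |∫ x in z..z + s * n, (‖f x 0‖ ^ 2 + ‖f x 1‖ ^ 2)| ≤ 1 / |lam.im| := by
  obtain ⟨m, hm, hmz⟩ := exists_isSolution ψ lam z ![1, 0]
  obtain ⟨k, hk, hkz⟩ := exists_isSolution ψ lam z ![0, 1]
  have hmc := hm.continuous
  have hkc := hk.continuous
  obtain ⟨S, hS, hSe⟩ : ∃ S : (Fin 2 → ℂ) → ℝ → Fin 2 → ℂ, (∀ v, IsSolution ψ lam (S v)) ∧
      ∀ v x i, S v x i = v 0 * m x i + v 1 * k x i :=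
    ⟨fun v x => v 0 • m x + v 1 • k x, fun v => (hm.const_smul _).add (hk.const_smul _),
      fun _ _ _ => rfl⟩
  have hSz : ∀ v, S v z = v := fun v => by
    ext i; fin_cases i <;> simp [hSe, hmz, hkz]
  let q : (Fin 2 → ℂ) → ℝ → ℝ := fun v x => ‖S v x 0‖ ^ 2 + ‖S v x 1‖ ^ 2
  have hqc : Continuous fun p : (Fin 2 → ℂ) × ℝ => q p.1 p.2 := by
    simp only [q, hSe]
    fun_prop
  have hqv : ∀ v, Continuous (q v) := fun v => hqc.comp (Continuous.prodMk_right v)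
  -- Unit initial vectors whose energy up to distance `n` obeys the bound. These sets are compact
  -- and decreasing, so a common element exists once each is nonempty.
  let K : ℕ → Set (Fin 2 → ℂ) := fun n =>
    {v | ‖v 0‖ ^ 2 + ‖v 1‖ ^ 2 = 1 ∧ |∫ x in z..z + s * n, q v x| ≤ 1 / |lam.im|}
  have hKcl : ∀ n, IsClosed (K n) := fun n => by
    have h : Continuous fun v => ∫ x in z..z + s * n, q v x :=
      intervalIntegral.continuous_parametric_intervalIntegral_of_continuous' hqc _ _
    have h1 : IsClosed {v : Fin 2 → ℂ | ‖v 0‖ ^ 2 + ‖v 1‖ ^ 2 = 1} :=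
      isClosed_eq (by fun_prop) continuous_const
    exact h1.inter (isClosed_le h.abs continuous_const)
  have hK0 : IsCompact (K 0) := by
    refine Metric.isCompact_of_isClosed_isBounded (hKcl 0)
      ((Metric.isBounded_closedBall (x := 0) (r := 1)).subset ?_)
    rintro v ⟨hv, -⟩
    rw [mem_closedBall_zero_iff, pi_norm_le_iff_of_nonneg zero_le_one, Fin.forall_fin_two]
    constructor <;> nlinarith [sq_nonneg ‖v 0‖, sq_nonneg ‖v 1‖]
  have hKmono : ∀ n, K (n + 1) ⊆ K n := by
    rintro n v ⟨hv, hb⟩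
    refine ⟨hv, le_trans ?_ hb⟩
    refine intervalIntegral.abs_integral_mono_interval ?_ (Eventually.of_forall fun x => ?_)
      ((hqv v).intervalIntegrable _ _)
    · refine uIoc_subset_uIoc_of_uIcc_subset_uIcc (uIcc_subset_uIcc_left ?_)
      rcases hs with rfl | rfl
      · rw [mem_uIcc]; left; push_cast; constructor <;> nlinarith [n.cast_nonneg (α := ℝ)]
      · rw [mem_uIcc]; right; push_cast; constructor <;> nlinarith [n.cast_nonneg (α := ℝ)]
    · simp only [q, Pi.zero_apply]; positivity
  have hKne : ∀ n, (K n).Nonempty := by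
    intro n
    set b := z + s * n
    -- Equal components at `b` make the form vanish there. The energy between `z` and `b` is then
    -- fixed by the form at `z`, which is at most 1 in absolute value on unit vectors.
    obtain ⟨u, hu0, hu⟩ : ∃ u : Fin 2 → ℂ, u ≠ 0 ∧ S u b 0 = S u b 1 := by
      by_cases hc : m b 0 - m b 1 = 0
      · refine ⟨![1, 0], fun h => by simpa using congrFun h 0, ?_⟩
        simpa [hSe, sub_eq_zero] using hc
      · refine ⟨![-(k b 0 - k b 1), m b 0 - m b 1], fun h => hc (by simpa using congrFun h 1), ?_⟩
        simp only [hSe, Matrix.cons_val_zero, Matrix.cons_val_one]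
        ring
    have hr : 0 < ‖u 0‖ ^ 2 + ‖u 1‖ ^ 2 := by
      by_contra hneg
      refine hu0 (funext (Fin.forall_fin_two.2 ⟨?_, ?_⟩)) <;>
      · rw [Pi.zero_apply, ← norm_eq_zero, ← sq_eq_zero_iff]
        nlinarith [sq_nonneg ‖u 0‖, sq_nonneg ‖u 1‖]
    set r := Real.sqrt (‖u 0‖ ^ 2 + ‖u 1‖ ^ 2) with hrdef
    have hr0 : 0 < r := Real.sqrt_pos.2 hr
    have hr2 : r ^ 2 = ‖u 0‖ ^ 2 + ‖u 1‖ ^ 2 := Real.sq_sqrt hr.le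
    set v : Fin 2 → ℂ := (r : ℂ)⁻¹ • u with hv
    have hv1 : ‖v 0‖ ^ 2 + ‖v 1‖ ^ 2 = 1 := by
      simp only [hv, Pi.smul_apply, norm_smul, norm_inv, Complex.norm_real,
        Real.norm_of_nonneg hr0.le, mul_pow]
      rw [← mul_add, ← hr2, ← mul_pow, inv_mul_cancel₀ hr0.ne', one_pow]
    refine ⟨v, hv1, ?_⟩
    have hvb : S v b 0 = S v b 1 := by
      have : ∀ i, S v b i = (r : ℂ)⁻¹ * S u b i := fun i => by
        simp only [hSe, hv, Pi.smul_apply, smul_eq_mul]; ring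
      rw [this, this, hu]
    have hint : ∫ x in z..b, lam.im * q v x = (‖S v b 0‖ ^ 2 - ‖S v b 1‖ ^ 2) -
        (‖S v z 0‖ ^ 2 - ‖S v z 1‖ ^ 2) :=
      intervalIntegral.integral_eq_sub_of_hasDerivAt (fun x _ => hasDerivAt_form (hS v) x)
        ((continuous_const.mul (hqv v)).intervalIntegrable _ _)
    rw [intervalIntegral.integral_const_mul, hvb, hSz, sub_self, zero_sub] at hint
    rw [le_div_iff₀ (abs_pos.2 hlam), ← abs_mul, mul_comm, hint, abs_neg]
    exact abs_le.2 ⟨by nlinarith [sq_nonneg ‖v 0‖], by nlinarith [sq_nonneg ‖v 1‖]⟩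
  obtain ⟨v, hv⟩ := IsCompact.nonempty_iInter_of_sequence_nonempty_isCompact_isClosed K hKmono
    hKne hK0 hKcl
  rw [mem_iInter] at hv
  refine ⟨S v, hS v, fun h => ?_, fun n => (hv n).2⟩
  have h0 : v = 0 := by rw [← hSz v, h]; rfl
  have := (hv 0).1
  simp [h0] at this

theorem notMem_gammaL {Q : Cover} (hR : Q ∈ GammaR) : Q ∉ GammaL := by
  intro hL
  simp only [GammaR, GammaL, mem_ofPred_eq] at hR hL
  rcases hR with ⟨h1, h2⟩ | ⟨h1, h2⟩ <;> rcases hL with ⟨h3, h4⟩ | ⟨h3, h4⟩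
  · linarith
  · simp [h1] at h3
  · simp [h1] at h3
  · linarith

theorem exists_isL2Solution_ne_zero (ψ : C(ℝ, ℂ)) (z : ℝ) (Q : Cover) :
    ∃ f, IsL2Solution ψ z Q f ∧ f ≠ 0 := by
  have hq : ∀ f : ℝ → Fin 2 → ℂ, IsSolution ψ Q.lam f →
      Continuous fun x => ‖f x 0‖ ^ 2 + ‖f x 1‖ ^ 2 := fun f hf => by
    have := hf.continuous
    fun_prop
  have hn : ∀ f : ℝ → Fin 2 → ℂ, ∀ x,
      ‖‖f x 0‖ ^ 2 + ‖f x 1‖ ^ 2‖ = ‖f x 0‖ ^ 2 + ‖f x 1‖ ^ 2 := fun f x =>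
    Real.norm_of_nonneg (by positivity)
  by_cases hR : Q ∈ GammaR
  · obtain ⟨f, hf, hf0, hb⟩ := exists_isSolution_integral_le ψ Q.im_ne_zero z 1 (Or.inl rfl)
    refine ⟨f, ⟨hf, fun _ => ?_, fun hL => absurd hL (notMem_gammaL hR)⟩, hf0⟩
    · rw [SquareIntegrableOn, integrableOn_Ici_iff_integrableOn_Ioi]
      refine integrableOn_Ioi_of_intervalIntegral_norm_bounded (l := atTop)
        (b := fun n : ℕ => z + 1 * n) (1 / |Q.lam.im|) z
        (fun n => ((hq f hf).integrableOn_Icc).mono_set Ioc_subset_Icc_self) ?_ ?_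
      · simpa using tendsto_atTop_add_const_left _ z tendsto_natCast_atTop_atTop
      · refine Eventually.of_forall fun n => ?_
        simp only [hn]
        exact (le_abs_self _).trans (hb n)
  · obtain ⟨f, hf, hf0, hb⟩ := exists_isSolution_integral_le ψ Q.im_ne_zero z (-1) (Or.inr rfl)
    refine ⟨f, ⟨hf, fun h => absurd h hR, fun _ => ?_⟩, hf0⟩
    refine integrableOn_Iic_of_intervalIntegral_norm_bounded (l := atTop)
        (a := fun n : ℕ => z + -1 * n) (1 / |Q.lam.im|) z
        (fun n => ((hq f hf).integrableOn_Icc).mono_set Ioc_subset_Icc_self) ?_ ?_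
    · simpa [sub_eq_add_neg] using
        tendsto_atBot_add_const_left _ z (tendsto_neg_atTop_atBot.comp
          (tendsto_natCast_atTop_atTop (R := ℝ)))
    · refine Eventually.of_forall fun n => ?_
      simp only [hn]
      rw [intervalIntegral.integral_symm]
      exact (neg_le_abs _).trans (hb n)

/-! ### Half-lines, energy and bilinear pairings -/

/-- `S` is the closed half-line with endpoint `z` on the side given by the sign `s`. -/
def IsHalfLine (S : Set ℝ) (z s : ℝ) : Prop :=
  S = Ici z ∧ s = 1 ∨ S = Iic z ∧ s = -1

namespace IsHalfLine

variable {S : Set ℝ} {z s : ℝ}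

theorem measurableSet (hS : IsHalfLine S z s) : MeasurableSet S := by
  rcases hS with ⟨rfl, -⟩ | ⟨rfl, -⟩
  exacts [measurableSet_Ici, measurableSet_Iic]

theorem sign_mul_self (hS : IsHalfLine S z s) : s * s = 1 := by
  rcases hS with ⟨-, rfl⟩ | ⟨-, rfl⟩ <;> norm_num

theorem abs_sign (hS : IsHalfLine S z s) : |s| = 1 := by
  rcases hS with ⟨-, rfl⟩ | ⟨-, rfl⟩ <;> norm_num

/-- Integrability of both `F` and `F'` forces `F` to vanish at infinity, so only the endpoint
contributes, with the sign of the orientation. -/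
theorem integral_deriv {E : Type*} [NormedAddCommGroup E] [NormedSpace ℝ E] [CompleteSpace E]
    (hS : IsHalfLine S z s) {F F' : ℝ → E} (hF : ∀ x, HasDerivAt F (F' x) x)
    (hi : IntegrableOn F S) (hi' : IntegrableOn F' S) : ∫ x in S, F' x = -s • F z := by
  rcases hS with ⟨rfl, rfl⟩ | ⟨rfl, rfl⟩
  · rw [integrableOn_Ici_iff_integrableOn_Ioi] at hi hi'
    rw [integral_Ici_eq_integral_Ioi, integral_Ioi_of_hasDerivAt_of_tendsto' (fun x _ => hF x) hi'
      (tendsto_zero_of_hasDerivAt_of_integrableOn_Ioi (fun x _ => hF x) hi' hi)]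
    simp
  · rw [integral_Iic_of_hasDerivAt_of_tendsto' (fun x _ => hF x) hi'
      (tendsto_zero_of_hasDerivAt_of_integrableOn_Iic (fun x _ => hF x) hi' hi)]
    simp

end IsHalfLine

/-- The total energy `∫ f* f` over `S`. -/
noncomputable def energy (S : Set ℝ) (f : ℝ → Fin 2 → ℂ) : ℝ :=
  ∫ x in S, (‖f x 0‖ ^ 2 + ‖f x 1‖ ^ 2)

theorem energy_nonneg (S : Set ℝ) (f : ℝ → Fin 2 → ℂ) : 0 ≤ energy S f :=
  integral_nonneg fun _ => by positivity

theorem norm_pairing_le {p q a b c d : ℂ} {η : ℝ} (hp : ‖p‖ ≤ η) (hq : ‖q‖ ≤ η) :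
    ‖p * (a * b) - q * (c * d)‖ ≤
      η * (Real.sqrt (‖a‖ ^ 2 + ‖c‖ ^ 2) * Real.sqrt (‖b‖ ^ 2 + ‖d‖ ^ 2)) := by
  have h1 : ‖a‖ * ‖b‖ + ‖c‖ * ‖d‖ ≤
      Real.sqrt (‖a‖ ^ 2 + ‖c‖ ^ 2) * Real.sqrt (‖b‖ ^ 2 + ‖d‖ ^ 2) := by
    rw [← Real.sqrt_mul (by positivity)]
    refine Real.le_sqrt_of_sq_le ?_
    nlinarith [sq_nonneg (‖a‖ * ‖d‖ - ‖c‖ * ‖b‖)]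
  have hη : 0 ≤ η := (norm_nonneg p).trans hp
  calc ‖p * (a * b) - q * (c * d)‖ ≤ ‖p‖ * (‖a‖ * ‖b‖) + ‖q‖ * (‖c‖ * ‖d‖) := by
        refine (norm_sub_le _ _).trans (le_of_eq ?_)
        simp only [norm_mul]
    _ ≤ η * (‖a‖ * ‖b‖) + η * (‖c‖ * ‖d‖) := by gcongr
    _ = η * (‖a‖ * ‖b‖ + ‖c‖ * ‖d‖) := by ring
    _ ≤ _ := by gcongr

section Pairing

variable {S : Set ℝ} {f g : ℝ → Fin 2 → ℂ} {p q : ℝ → ℂ} {η : ℝ}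

theorem continuous_pairing (hf : Continuous f) (hg : Continuous g) (hp : Continuous p)
    (hq : Continuous q) :
    Continuous fun x => p x * (f x 0 * g x 0) - q x * (f x 1 * g x 1) := by fun_prop

theorem integrableOn_pairing (hf : Continuous f) (hg : Continuous g) (hp : Continuous p)
    (hq : Continuous q) (hpη : ∀ x, ‖p x‖ ≤ η) (hqη : ∀ x, ‖q x‖ ≤ η)
    (hfi : SquareIntegrableOn f S) (hgi : SquareIntegrableOn g S) :
    IntegrableOn (fun x => p x * (f x 0 * g x 0) - q x * (f x 1 * g x 1)) S := by
  refine Integrable.mono' ((hfi.add hgi).const_mul η)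
    (continuous_pairing hf hg hp hq).aestronglyMeasurable (Eventually.of_forall fun x => ?_)
  refine (norm_pairing_le (hpη x) (hqη x)).trans ?_
  have hη : 0 ≤ η := (norm_nonneg _).trans (hpη x)
  refine mul_le_mul_of_nonneg_left ?_ hη
  have h1 := Real.sq_sqrt (x := ‖f x 0‖ ^ 2 + ‖f x 1‖ ^ 2) (by positivity)
  have h2 := Real.sq_sqrt (x := ‖g x 0‖ ^ 2 + ‖g x 1‖ ^ 2) (by positivity)
  simp only [Pi.add_apply]
  nlinarith [sq_nonneg (Real.sqrt (‖f x 0‖ ^ 2 + ‖f x 1‖ ^ 2) -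
    Real.sqrt (‖g x 0‖ ^ 2 + ‖g x 1‖ ^ 2)),
    sq_nonneg (Real.sqrt (‖f x 0‖ ^ 2 + ‖f x 1‖ ^ 2)),
    sq_nonneg (Real.sqrt (‖g x 0‖ ^ 2 + ‖g x 1‖ ^ 2))]

theorem memLp_sqrt_density (hf : Continuous f) (hfi : SquareIntegrableOn f S) :
    MemLp (fun x => Real.sqrt (‖f x 0‖ ^ 2 + ‖f x 1‖ ^ 2)) (ENNReal.ofReal 2)
      (volume.restrict S) := by
  have hc : Continuous fun x => Real.sqrt (‖f x 0‖ ^ 2 + ‖f x 1‖ ^ 2) := by fun_prop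
  rw [ENNReal.ofReal_ofNat, memLp_two_iff_integrable_sq hc.aestronglyMeasurable]
  refine hfi.congr (Eventually.of_forall fun x => ?_)
  exact (Real.sq_sqrt (by positivity)).symm

/-- The Cauchy-Schwarz inequality for a bounded bilinear pairing of spinors. -/
theorem norm_integral_pairing_le (hf : Continuous f) (hg : Continuous g)
    (hpη : ∀ x, ‖p x‖ ≤ η) (hqη : ∀ x, ‖q x‖ ≤ η)
    (hfi : SquareIntegrableOn f S) (hgi : SquareIntegrableOn g S) :
    ‖∫ x in S, (p x * (f x 0 * g x 0) - q x * (f x 1 * g x 1))‖ ≤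
      η * (Real.sqrt (energy S f) * Real.sqrt (energy S g)) := by
  have hη : 0 ≤ η := (norm_nonneg _).trans (hpη 0)
  have hfm := memLp_sqrt_density hf hfi
  have hgm := memLp_sqrt_density hg hgi
  have hpq : Real.HolderConjugate 2 2 := Real.HolderConjugate.two_two
  have hint : IntegrableOn (fun x => Real.sqrt (‖f x 0‖ ^ 2 + ‖f x 1‖ ^ 2) *
      Real.sqrt (‖g x 0‖ ^ 2 + ‖g x 1‖ ^ 2)) S := by
    rw [ENNReal.ofReal_ofNat] at hfm hgm
    exact hfm.integrable_mul hgm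
  have hcs := integral_mul_le_Lp_mul_Lq_of_nonneg hpq
    (Eventually.of_forall fun x => Real.sqrt_nonneg (‖f x 0‖ ^ 2 + ‖f x 1‖ ^ 2))
    (Eventually.of_forall fun x => Real.sqrt_nonneg (‖g x 0‖ ^ 2 + ‖g x 1‖ ^ 2)) hfm hgm
  have hE : ∀ u : ℝ → Fin 2 → ℂ,
      (∫ x in S, Real.sqrt (‖u x 0‖ ^ 2 + ‖u x 1‖ ^ 2) ^ (2 : ℝ)) ^ (1 / 2 : ℝ) =
        Real.sqrt (energy S u) := fun u => by
    rw [Real.sqrt_eq_rpow, energy]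
    congr 1
    refine integral_congr_ae (Eventually.of_forall fun x => ?_)
    simp only [Real.rpow_two]
    exact Real.sq_sqrt (by positivity)
  rw [hE, hE] at hcs
  refine (norm_integral_le_of_norm_le (hint.const_mul η)
    (Eventually.of_forall fun x => norm_pairing_le (hpη x) (hqη x))).trans ?_
  rw [integral_const_mul]
  exact mul_le_mul_of_nonneg_left hcs hη

theorem SquareIntegrableOn.sub (hf : Continuous f) (hg : Continuous g)
    (hfi : SquareIntegrableOn f S) (hgi : SquareIntegrableOn g S) :
    SquareIntegrableOn (fun x => g x - f x) S := by
  have hc : Continuous fun x => ‖(g x - f x) 0‖ ^ 2 + ‖(g x - f x) 1‖ ^ 2 := by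
    simp only [Pi.sub_apply]; fun_prop
  refine Integrable.mono' ((hfi.add hgi).const_mul 2) hc.aestronglyMeasurable
    (Eventually.of_forall fun x => ?_)
  rw [Real.norm_of_nonneg (by positivity)]
  simp only [Pi.add_apply, Pi.sub_apply]
  have h0 := norm_sub_le (g x 0) (f x 0)
  have h1 := norm_sub_le (g x 1) (f x 1)
  nlinarith [sq_nonneg (‖g x 0‖ - ‖f x 0‖), sq_nonneg (‖g x 1‖ - ‖f x 1‖),
    norm_nonneg (g x 0 - f x 0), norm_nonneg (g x 1 - f x 1)]

/-- Serves to trade the unknown energy of `g` for that of the difference, which can be absorbed. -/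
theorem energy_le (hf : Continuous f) (hg : Continuous g)
    (hfi : SquareIntegrableOn f S) (hgi : SquareIntegrableOn g S) :
    energy S g ≤ 2 * energy S f + 2 * energy S (fun x => g x - f x) := by
  have hd := hfi.sub hf hg hgi
  rw [energy, energy, energy, ← integral_const_mul, ← integral_const_mul,
    ← integral_add (hfi.const_mul 2) (hd.const_mul 2)]
  refine integral_mono hgi ((hfi.const_mul 2).add (hd.const_mul 2)) fun x => ?_
  simp only [Pi.sub_apply]
  have h0 := norm_add_le (f x 0) (g x 0 - f x 0)
  have h1 := norm_add_le (f x 1) (g x 1 - f x 1)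
  rw [add_sub_cancel] at h0 h1
  nlinarith [sq_nonneg (‖g x 0 - f x 0‖ - ‖f x 0‖), sq_nonneg (‖g x 1 - f x 1‖ - ‖f x 1‖),
    norm_nonneg (g x 0), norm_nonneg (g x 1)]

end Pairing

/-! ### Comparison of solutions for two potentials -/

section Perturbation

variable {S : Set ℝ} {z s η : ℝ} {ψ φ : C(ℝ, ℂ)} {lam : ℂ} {f g : ℝ → Fin 2 → ℂ}

/-- When both first components are 1 at `z`, the left side is the difference of the second
components there: an exact increment formula for the Weyl function. -/
theorem wronskian_eq_integral (hS : IsHalfLine S z s) (hf : IsSolution ψ lam f)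
    (hg : IsSolution φ lam g) (hfi : SquareIntegrableOn f S) (hgi : SquareIntegrableOn g S)
    (hη : ∀ x, ‖φ x - ψ x‖ ≤ η) :
    f z 0 * g z 1 - f z 1 * g z 0 = -s * ∫ x in S, ((φ x - ψ x) * (f x 0 * g x 0) -
      (starRingEnd ℂ) (φ x - ψ x) * (f x 1 * g x 1)) := by
  have hfc := hf.continuous
  have hgc := hg.continuous
  have hp : Continuous fun x => φ x - ψ x := by fun_prop
  have hw : IntegrableOn (fun x => f x 0 * g x 1 - f x 1 * g x 0) S := by
    -- With the components of `g` swapped, the Wronskian is itself a pairing with `p = q = 1`, so it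
    -- is integrable.
    have hgc' : Continuous fun x => ![g x 1, g x 0] := by
      refine continuous_pi (Fin.forall_fin_two.2 ⟨?_, ?_⟩) <;> simp <;> fun_prop
    have hgi' : SquareIntegrableOn (fun x => ![g x 1, g x 0]) S := by
      simpa [SquareIntegrableOn, add_comm] using hgi
    simpa using integrableOn_pairing (p := fun _ => 1) (q := fun _ => 1) (η := 1) hfc hgc'
      continuous_const continuous_const (by simp) (by simp) hfi hgi'
  rw [hS.integral_deriv (hasDerivAt_wronskian hf hg) hw
    (integrableOn_pairing hfc hgc hp (Complex.continuous_conj.comp hp) hη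
      (fun x => (RCLike.norm_conj _).trans_le (hη x)) hfi hgi), Complex.real_smul, ← mul_assoc]
  have := hS.sign_mul_self
  have h2 : (s : ℂ) * s = 1 := by exact_mod_cast this
  push_cast
  rw [neg_mul_neg, h2, one_mul]

theorem norm_wronskian_le (hS : IsHalfLine S z s) (hf : IsSolution ψ lam f)
    (hg : IsSolution φ lam g) (hfi : SquareIntegrableOn f S) (hgi : SquareIntegrableOn g S)
    (hη : ∀ x, ‖φ x - ψ x‖ ≤ η) :
    ‖f z 0 * g z 1 - f z 1 * g z 0‖ ≤ η * (Real.sqrt (energy S f) * Real.sqrt (energy S g)) := by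
  rw [wronskian_eq_integral hS hf hg hfi hgi hη, norm_mul, norm_neg, Complex.norm_real,
    Real.norm_eq_abs, hS.abs_sign, one_mul]
  exact norm_integral_pairing_le hf.continuous hg.continuous hη (fun x => (RCLike.norm_conj _).trans_le (hη x))
    hfi hgi

/-- The derivative of the form of `g - f` is integrated over `S`. It consists of `Im λ` times the
density of `g - f` and a source term, which is a pairing of the conjugate of `g - f` with the
swapped `f` and so falls under Cauchy-Schwarz. -/
theorem energy_sub_le (hS : IsHalfLine S z s) (hf : IsSolution ψ lam f)
    (hg : IsSolution φ lam g) (hfi : SquareIntegrableOn f S) (hgi : SquareIntegrableOn g S)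
    (hη : ∀ x, ‖φ x - ψ x‖ ≤ η) :
    |lam.im| * energy S (fun x => g x - f x) ≤
      |‖g z 0 - f z 0‖ ^ 2 - ‖g z 1 - f z 1‖ ^ 2| +
        2 * (η * (Real.sqrt (energy S (fun x => g x - f x)) * Real.sqrt (energy S f))) := by
  have hfc := hf.continuous
  have hgc := hg.continuous
  have hp : Continuous fun x => φ x - ψ x := by fun_prop
  have hd : SquareIntegrableOn (fun x => g x - f x) S := hfi.sub hfc hgc hgi
  have hfc' : Continuous fun x => ![f x 1, f x 0] := by
    refine continuous_pi (Fin.forall_fin_two.2 ⟨?_, ?_⟩) <;> simp <;> fun_prop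
  have hfi' : SquareIntegrableOn (fun x => ![f x 1, f x 0]) S := by
    simpa [SquareIntegrableOn, add_comm] using hfi
  have hdc' : Continuous fun x => fun i => (starRingEnd ℂ) (g x i - f x i) :=
    continuous_pi fun i => Complex.continuous_conj.comp (by fun_prop)
  have hd' : SquareIntegrableOn (fun x => fun i => (starRingEnd ℂ) (g x i - f x i)) S := by
    simpa only [SquareIntegrableOn, RCLike.norm_conj, Pi.sub_apply] using hd
  have hi := integrableOn_pairing hdc' hfc' (Complex.continuous_conj.comp hp) hp
    (fun x => (RCLike.norm_conj _).trans_le (hη x)) hη hd' hfi'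
  have hle := norm_integral_pairing_le (p := fun x => (starRingEnd ℂ) (φ x - ψ x))
    (q := fun x => φ x - ψ x) hdc' hfc' (fun x => (RCLike.norm_conj _).trans_le (hη x)) hη hd' hfi'
  have he1 : energy S (fun x => fun i => (starRingEnd ℂ) (g x i - f x i)) =
      energy S (fun x => g x - f x) := by
    simp only [energy, RCLike.norm_conj, Pi.sub_apply]
  have he2 : energy S (fun x => ![f x 1, f x 0]) = energy S f := by
    simp [energy, add_comm]
  rw [he1, he2] at hle
  set B : ℝ → ℂ := fun x => (starRingEnd ℂ) (g x 0 - f x 0) *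
    ((starRingEnd ℂ) (φ x - ψ x) * f x 1) -
    (starRingEnd ℂ) (g x 1 - f x 1) * ((φ x - ψ x) * f x 0) with hB
  have hBeq : (fun x => (starRingEnd ℂ) (φ x - ψ x) *
      ((starRingEnd ℂ) (g x 0 - f x 0) * ![f x 1, f x 0] 0) -
      (φ x - ψ x) * ((starRingEnd ℂ) (g x 1 - f x 1) * ![f x 1, f x 0] 1)) = B := by
    funext x
    simp only [hB, Matrix.cons_val_zero, Matrix.cons_val_one]
    ring
  have hBi : IntegrableOn B S := by rw [← hBeq]; exact hi
  have hBle : ‖∫ x in S, B x‖ ≤ η * (Real.sqrt (energy S (fun x => g x - f x)) *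
      Real.sqrt (energy S f)) := by rw [← hBeq]; exact hle
  have hre : ∫ x in S, (B x).re = (∫ x in S, B x).re :=
    Complex.reCLM.integral_comp_comm hBi
  have hBre : IntegrableOn (fun x => (B x).re) S := Complex.reCLM.integrable_comp hBi
  have hN : IntegrableOn (fun x => ‖g x 0 - f x 0‖ ^ 2 - ‖g x 1 - f x 1‖ ^ 2) S := by
    have hc : Continuous fun x => ‖g x 0 - f x 0‖ ^ 2 - ‖g x 1 - f x 1‖ ^ 2 := by fun_prop
    refine Integrable.mono' hd hc.aestronglyMeasurable (Eventually.of_forall fun x => ?_)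
    rw [Real.norm_eq_abs, abs_le]
    simp only [Pi.sub_apply]
    constructor <;> nlinarith [sq_nonneg ‖g x 0 - f x 0‖, sq_nonneg ‖g x 1 - f x 1‖]
  have hder := hS.integral_deriv (hasDerivAt_form_sub hf hg) hN
    ((hd.const_mul lam.im).add (hBre.const_mul 2))
  have hsplit : ∫ x in S, (lam.im * (‖g x 0 - f x 0‖ ^ 2 + ‖g x 1 - f x 1‖ ^ 2) +
      2 * (B x).re) = lam.im * energy S (fun x => g x - f x) + 2 * (∫ x in S, B x).re := by
    rw [← hre, energy, ← integral_const_mul, ← integral_const_mul]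
    exact integral_add (hd.const_mul lam.im) (hBre.const_mul 2)
  rw [hsplit, smul_eq_mul] at hder
  have hre2 : |(∫ x in S, B x).re| ≤ ‖∫ x in S, B x‖ := Complex.abs_re_le_norm _
  set N := ‖g z 0 - f z 0‖ ^ 2 - ‖g z 1 - f z 1‖ ^ 2
  calc |lam.im| * energy S (fun x => g x - f x)
      = |lam.im * energy S (fun x => g x - f x)| := by
        rw [abs_mul, abs_of_nonneg (energy_nonneg _ _)]
    _ = |-s * N - 2 * (∫ x in S, B x).re| := by rw [← hder]; congr 1; ring
    _ ≤ |-s * N| + |2 * (∫ x in S, B x).re| := abs_sub _ _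
    _ = |N| + 2 * |(∫ x in S, B x).re| := by
        rw [abs_mul, abs_neg, hS.abs_sign, one_mul, abs_mul, abs_two]
    _ ≤ _ := by linarith

/-- If the unperturbed problem has a normalized square integrable solution, then for a small
perturbation a square integrable solution whose first component vanishes at the endpoint is
trivial. -/
theorem eq_zero_of_apply_zero_eq_zero (hS : IsHalfLine S z s) (hf : IsSolution ψ lam f)
    (hg : IsSolution φ lam g) (hfi : SquareIntegrableOn f S) (hgi : SquareIntegrableOn g S)
    (hη : ∀ x, ‖φ x - ψ x‖ ≤ η) (hfz : f z 0 = 1) (hsmall : η ^ 2 * energy S f < |lam.im|)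
    (hgz : g z 0 = 0) : g = 0 := by
  have hw := norm_wronskian_le hS hf hg hfi hgi hη
  have hzero : SquareIntegrableOn (fun _ => (0 : Fin 2 → ℂ)) S := by
    simp [SquareIntegrableOn]
  -- Comparison with the zero solution for the same potential gives `|Im λ| E(g) ≤ |g₂(z)|²`, while
  -- the Wronskian gives `|g₂(z)|² ≤ η² E(f) E(g)`. Smallness of `η` leaves only `E(g) = 0`.
  have he := energy_sub_le (η := 0) hS (IsSolution.zero φ lam) hg hzero hgi (by simp)
  simp only [hfz, hgz, one_mul, mul_zero, sub_zero] at hw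
  simp only [sub_zero, Pi.zero_apply, hgz, norm_zero, zero_mul, mul_zero, add_zero, ne_eq,
    OfNat.ofNat_ne_zero, not_false_eq_true, zero_pow, zero_sub, abs_neg, abs_pow, abs_norm] at he
  have hsq : ‖g z 1‖ ^ 2 ≤ η ^ 2 * energy S f * energy S g := by
    have := pow_le_pow_left₀ (norm_nonneg _) hw 2
    rwa [mul_pow, mul_pow, Real.sq_sqrt (energy_nonneg _ _), Real.sq_sqrt (energy_nonneg _ _),
      ← mul_assoc] at this
  have hG : energy S g = 0 := by
    have := energy_nonneg S g
    by_contra hne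
    have hpos : 0 < energy S g := lt_of_le_of_ne this (Ne.symm hne)
    have := mul_lt_mul_of_pos_right hsmall hpos
    linarith
  rw [hG, mul_zero] at hsq
  have hg1 : g z 1 = 0 := by
    rw [← norm_eq_zero, ← sq_eq_zero_iff]
    exact le_antisymm hsq (sq_nonneg _)
  exact hg.eq_zero (funext (Fin.forall_fin_two.2 ⟨hgz, hg1⟩))

/-- With `E`, `D`, `G` the energies of `f`, `g - f`, `g`, the Wronskian bounds the boundary term by
`η² E G`, and `G ≤ 2E + 2D`; AM-GM bounds the source by `η (D + E)`. In total `D` has coefficient `η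
(2E + 1)` on the right, and half of `|Im λ|` absorbs it. -/
theorem energy_sub_le_of_small (hS : IsHalfLine S z s) (hf : IsSolution ψ lam f)
    (hg : IsSolution φ lam g) (hfi : SquareIntegrableOn f S) (hgi : SquareIntegrableOn g S)
    (hη : ∀ x, ‖φ x - ψ x‖ ≤ η) (hfz : f z 0 = 1) (hgz : g z 0 = 1) (hη1 : η ≤ 1)
    (hsmall : η * (2 * energy S f + 1) ≤ |lam.im| / 2) :
    |lam.im| / 2 * energy S (fun x => g x - f x) ≤
      η * (2 * energy S f ^ 2 + energy S f) := by
  have hη0 : 0 ≤ η := (norm_nonneg _).trans (hη 0)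
  have hw := norm_wronskian_le hS hf hg hfi hgi hη
  have he := energy_sub_le hS hf hg hfi hgi hη
  have hG := energy_le hf.continuous hg.continuous hfi hgi
  simp only [hfz, hgz, one_mul, mul_one] at hw
  simp only [hfz, hgz, sub_self, norm_zero, ne_eq, OfNat.ofNat_ne_zero, not_false_eq_true,
    zero_pow, zero_sub, abs_neg, abs_pow, abs_norm] at he
  have hE := energy_nonneg S f
  have hD := energy_nonneg S (fun x => g x - f x)
  have hsq : ‖g z 1 - f z 1‖ ^ 2 ≤ η ^ 2 * (energy S f * energy S g) := by
    have := pow_le_pow_left₀ (norm_nonneg _) hw 2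
    rwa [mul_pow, mul_pow, Real.sq_sqrt (energy_nonneg _ _),
      Real.sq_sqrt (energy_nonneg _ _)] at this
  have hsD := Real.sq_sqrt hD
  have hsE := Real.sq_sqrt hE
  set E := energy S f
  set D := energy S (fun x => g x - f x)
  set G := energy S g
  have h1 : 2 * (Real.sqrt D * Real.sqrt E) ≤ D + E := by
    nlinarith [sq_nonneg (Real.sqrt D - Real.sqrt E)]
  have h2 : 2 * (η * (Real.sqrt D * Real.sqrt E)) ≤ η * (D + E) := by
    nlinarith
  have h3 : η ^ 2 * (E * G) ≤ η * (E * (2 * E + 2 * D)) := by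
    have : E * G ≤ E * (2 * E + 2 * D) := mul_le_mul_of_nonneg_left hG hE
    have h4 : η ^ 2 ≤ η := by nlinarith
    exact mul_le_mul h4 this (mul_nonneg hE (energy_nonneg _ _)) hη0
  have h5 := mul_le_mul_of_nonneg_right hsmall hD
  nlinarith

end Perturbation

/-! ### Existence and uniqueness of the Weyl solution -/

section WeylSolution

variable {ψ : C(ℝ, ℂ)} {z : ℝ} {Q : Cover} {f g : ℝ → Fin 2 → ℂ}

theorem isWeylSolution_weylSolution (h : ∃ f, IsWeylSolution ψ z Q f) :
    IsWeylSolution ψ z Q (fun x => weylSolution ψ x z Q) := by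
  have : (fun x => weylSolution ψ x z Q) = h.choose := by
    funext x
    rw [weylSolution, dif_pos h]
  rw [this]
  exact h.choose_spec

theorem weylFunction_eq (h : ∃! f, IsWeylSolution ψ z Q f) (hf : IsWeylSolution ψ z Q f) :
    weylFunction ψ z Q = f z 1 :=
  congrFun (congrFun (h.unique (isWeylSolution_weylSolution h.exists) hf) z) 1

theorem IsL2Solution.const_smul (c : ℂ) (hf : IsL2Solution ψ z Q f) :
    IsL2Solution ψ z Q (fun x => c • f x) := by
  have h : ∀ S, SquareIntegrableOn f S → SquareIntegrableOn (fun x => c • f x) S := fun S hS => by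
    refine (hS.const_mul (‖c‖ ^ 2)).congr (Eventually.of_forall fun x => ?_)
    simp only [Pi.smul_apply, norm_smul]
    ring
  exact ⟨hf.1.const_smul c, fun hQ => h _ (hf.2.1 hQ), fun hQ => h _ (hf.2.2 hQ)⟩

theorem IsL2Solution.sub (hf : IsL2Solution ψ z Q f) (hg : IsL2Solution ψ z Q g) :
    IsL2Solution ψ z Q (fun x => g x - f x) :=
  ⟨hg.1.sub hf.1,
    fun hQ => (hf.2.1 hQ).sub hf.1.continuous hg.1.continuous (hg.2.1 hQ),
    fun hQ => (hf.2.2 hQ).sub hf.1.continuous hg.1.continuous (hg.2.2 hQ)⟩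

/-- Existence is by rescaling a nontrivial square integrable solution. For uniqueness, the
difference of two normalized ones has vanishing first component at `z`, hence is trivial. -/
theorem WeylFinite.existsUnique (h : WeylFinite ψ z Q) : ∃! f, IsWeylSolution ψ z Q f := by
  obtain ⟨f, hf, hf0⟩ := exists_isL2Solution_ne_zero ψ z Q
  have hz := h f hf hf0
  refine existsUnique_of_exists_of_unique ⟨_, hf.const_smul (f z 0)⁻¹, ?_⟩ ?_
  · simp [hz]
  · rintro u v ⟨hu, huz⟩ ⟨hv, hvz⟩
    by_contra hne
    refine h _ (hv.sub hu) (fun h0 => hne (funext fun x => ?_)) (by simp [huz, hvz])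
    exact sub_eq_zero.1 (congrFun h0 x)

end WeylSolution

/-! ### Differentiability of the Weyl function -/

/-- The derivative `h ↦ ∫ (G h + H h̄)` as a bounded real linear functional. -/
theorem exists_gradient_functional {G H : ℝ → ℂ} (hG : Integrable G) (hH : Integrable H) :
    ∃ L : (ℝ →ᵇ ℂ) →L[ℝ] ℂ,
      ∀ h : ℝ →ᵇ ℂ, L h = ∫ y, (G y * h y + H y * (starRingEnd ℂ) (h y)) := by
  have hGi : ∀ h : ℝ →ᵇ ℂ, Integrable fun y => G y * h y := fun h =>
    hG.mul_bdd h.continuous.aestronglyMeasurable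
      (Eventually.of_forall fun y => h.norm_coe_le_norm y)
  have hHi : ∀ h : ℝ →ᵇ ℂ, Integrable fun y => H y * (starRingEnd ℂ) (h y) := fun h =>
    hH.mul_bdd (Complex.continuous_conj.comp h.continuous).aestronglyMeasurable
      (Eventually.of_forall fun y => (RCLike.norm_conj _).trans_le (h.norm_coe_le_norm y))
  have hGHi : ∀ h : ℝ →ᵇ ℂ, Integrable fun y => G y * h y + H y * (starRingEnd ℂ) (h y) :=
    fun h => (hGi h).add (hHi h)
  let L₀ : (ℝ →ᵇ ℂ) →ₗ[ℝ] ℂ :=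
    { toFun := fun h => ∫ y, (G y * h y + H y * (starRingEnd ℂ) (h y))
      map_add' := fun h k => by
        rw [← integral_add (hGHi h) (hGHi k)]
        refine integral_congr_ae (Eventually.of_forall fun y => ?_)
        simp only [BoundedContinuousFunction.coe_add, Pi.add_apply, map_add]
        ring
      map_smul' := fun c h => by
        rw [RingHom.id_apply, ← integral_smul]
        refine integral_congr_ae (Eventually.of_forall fun y => ?_)
        simp only [BoundedContinuousFunction.coe_smul, Complex.real_smul, map_mul,
          Complex.conj_ofReal]
        ring }
  refine ⟨L₀.mkContinuous (∫ y, (‖G y‖ + ‖H y‖)) fun h => ?_, fun h => rfl⟩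
  change ‖∫ y, (G y * h y + H y * (starRingEnd ℂ) (h y))‖ ≤ _
  rw [← integral_mul_const]
  refine norm_integral_le_of_norm_le ((hG.norm.add hH.norm).mul_const _)
    (Eventually.of_forall fun y => (norm_add_le _ _).trans ?_)
  rw [norm_mul, norm_mul, RCLike.norm_conj, add_mul]
  have := h.norm_coe_le_norm y
  gcongr

open Classical in
/-- The functional gradients of the Weyl function, on either half-line. -/
theorem hasFunctionalGradients_weylFunction {ψ : C(ℝ, ℂ)} {z s : ℝ} {S : Set ℝ} {Q : Cover}
    (hS : IsHalfLine S z s)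
    (hQ : ∀ φ f, IsL2Solution φ z Q f → SquareIntegrableOn f S) (hfin : WeylFinite ψ z Q) :
    (∀ᶠ h : ℝ →ᵇ ℂ in 𝓝 0, ∃! e, IsWeylSolution (ψ + h.toContinuousMap) z Q e) ∧
    HasFunctionalGradients (fun φ => weylFunction φ z Q) ψ
      (fun y => if y ∈ S then -s * weylSolution ψ y z Q 0 ^ 2 else 0)
      (fun y => if y ∈ S then s * weylSolution ψ y z Q 1 ^ 2 else 0) := by
  have heU := hfin.existsUnique
  have heW := isWeylSolution_weylSolution heU.exists
  have hX := weylFunction_eq heU heW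
  set e : ℝ → Fin 2 → ℂ := fun x => weylSolution ψ x z Q with hedef
  obtain ⟨heL, hez⟩ := heW
  have hes := heL.1
  have hec := hes.continuous
  have hei := hQ _ _ heL
  set E := energy S e with hE
  have hE0 : 0 ≤ E := energy_nonneg _ _
  have hmu : 0 < |Q.lam.im| := abs_pos.2 Q.im_ne_zero
  have hdiff : ∀ (h : ℝ →ᵇ ℂ) (x : ℝ), (ψ + h.toContinuousMap) x - ψ x = h x := fun h x => by
    simp
  have hη : ∀ (h : ℝ →ᵇ ℂ) (x : ℝ), ‖(ψ + h.toContinuousMap) x - ψ x‖ ≤ ‖h‖ := fun h x => by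
    rw [hdiff]; exact h.norm_coe_le_norm x
  have hev : ∀ c d : ℝ, 0 < d → ∀ᶠ h : ℝ →ᵇ ℂ in 𝓝 0, ‖h‖ * c < d := fun c d hd => by
    have : Tendsto (fun h : ℝ →ᵇ ℂ => ‖h‖ * c) (𝓝 0) (𝓝 (‖(0 : ℝ →ᵇ ℂ)‖ * c)) :=
      (continuous_norm.mul continuous_const).continuousAt
    rw [norm_zero, zero_mul] at this
    exact this.eventually_lt_const hd
  have hone := hev 1 1 one_pos
  have huniq : ∀ᶠ h : ℝ →ᵇ ℂ in 𝓝 0, ∃! e, IsWeylSolution (ψ + h.toContinuousMap) z Q e := by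
    filter_upwards [hone, hev E _ hmu] with h h1 h2
    refine WeylFinite.existsUnique fun g hg hg0 hgz => hg0 ?_
    refine eq_zero_of_apply_zero_eq_zero hS hes hg.1 hei (hQ _ _ hg) (hη h) hez ?_ hgz
    have : ‖h‖ ^ 2 ≤ ‖h‖ := by nlinarith [norm_nonneg h]
    exact (mul_le_mul_of_nonneg_right this hE0).trans_lt h2
  have hsq : ∀ i, IntegrableOn (fun y => e y i ^ 2) S := fun i => by
    have hc : Continuous fun y => e y i ^ 2 := by fun_prop
    refine Integrable.mono' hei hc.aestronglyMeasurable (Eventually.of_forall fun y => ?_)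
    rw [norm_pow]
    fin_cases i
    · exact le_add_of_nonneg_right (sq_nonneg _)
    · exact le_add_of_nonneg_left (sq_nonneg _)
  have hG : Integrable (fun y => if y ∈ S then -s * e y 0 ^ 2 else 0) :=
    (integrable_indicator_iff hS.measurableSet).2 ((hsq 0).const_mul (-s : ℂ))
  have hH : Integrable (fun y => if y ∈ S then s * e y 1 ^ 2 else 0) :=
    (integrable_indicator_iff hS.measurableSet).2 ((hsq 1).const_mul (s : ℂ))
  obtain ⟨L, hL⟩ := exists_gradient_functional hG hH
  refine ⟨huniq, hG, hH, L, hL, ?_⟩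
  have hLS : ∀ h : ℝ →ᵇ ℂ, L h = -s * ∫ y in S, (h y * (e y 0 * e y 0) -
      (starRingEnd ℂ) (h y) * (e y 1 * e y 1)) := fun h => by
    rw [hL, ← integral_const_mul, ← integral_indicator hS.measurableSet]
    refine integral_congr_ae (Eventually.of_forall fun y => ?_)
    by_cases hy : y ∈ S
    · simp only [hy, if_true, indicator_of_mem]; ring
    · simp [hy]
  rw [hasFDerivAt_iff_isLittleO_nhds_zero, Asymptotics.isLittleO_iff]
  intro c hc
  -- `‖h‖ * K` bounds the energy of `g - e`, so the remainder is at most `‖h‖ * √(E * K * ‖h‖)`; the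
  -- condition `‖h‖ * (E * K) < c ^ 2` makes the root smaller than `c`.
  set K := 2 * (2 * E ^ 2 + E) / |Q.lam.im| with hK
  filter_upwards [hone, huniq, hev (2 * E + 1) (|Q.lam.im| / 2) (by positivity),
    hev (E * K) (c ^ 2) (by positivity)] with h h1 h2 h3 h4
  obtain ⟨g, hgW⟩ := h2.exists
  have hXg := weylFunction_eq h2 hgW
  obtain ⟨hgL, hgz⟩ := hgW
  have hgi := hQ _ _ hgL
  have hgc := hgL.1.continuous
  have hdi := hei.sub hec hgc hgi
  have hD := energy_sub_le_of_small hS hes hgL.1 hei hgi (hη h) hez hgz (by linarith) h3.le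
  have hDK : energy S (fun x => g x - e x) ≤ ‖h‖ * K := by
    rw [hK, mul_div_assoc', le_div_iff₀ hmu]
    linarith
  have hW := wronskian_eq_integral hS hes hgL.1 hei hgi (hη h)
  simp only [hdiff, hez, hgz, one_mul, mul_one] at hW
  have hbd : ∀ x, ‖h x‖ ≤ ‖h‖ := h.norm_coe_le_norm
  have hbd' : ∀ x, ‖(starRingEnd ℂ) (h x)‖ ≤ ‖h‖ := fun x =>
    (RCLike.norm_conj _).trans_le (hbd x)
  have hhc : Continuous fun x => (starRingEnd ℂ) (h x) := Complex.continuous_conj.comp h.continuous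
  -- The increment formula is linear in `g`, and `L h` is its value with `e` in place of `g`.
  have hrem : g z 1 - e z 1 - L h = -s * ∫ y in S, (h y * (e y 0 * (g y - e y) 0) -
      (starRingEnd ℂ) (h y) * (e y 1 * (g y - e y) 1)) := by
    rw [hW, hLS, ← mul_sub, ← integral_sub
      (integrableOn_pairing hec hgc h.continuous hhc hbd hbd' hei hgi)
      (integrableOn_pairing hec hec h.continuous hhc hbd hbd' hei hei)]
    congr 1
    refine integral_congr_ae (Eventually.of_forall fun y => ?_)
    simp only [Pi.sub_apply]
    ring
  have hψ0 : ψ + (0 : ℝ →ᵇ ℂ).toContinuousMap = ψ := by ext; simp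
  simp only [zero_add, hψ0]
  rw [hXg, hX, hrem, norm_mul, norm_neg, Complex.norm_real, Real.norm_eq_abs, hS.abs_sign, one_mul]
  refine (norm_integral_pairing_le hec (hgc.sub hec) hbd hbd' hei hdi).trans ?_
  rw [mul_comm c]
  refine mul_le_mul_of_nonneg_left ?_ (norm_nonneg h)
  rw [← Real.sqrt_mul hE0]
  refine Real.sqrt_le_iff.2 ⟨hc.le, ?_⟩
  have := mul_le_mul_of_nonneg_left hDK hE0
  change E * energy S (fun x => g x - e x) ≤ c ^ 2
  linarith

theorem mem_gammaR_or_mem_gammaL (Q : Cover) : Q ∈ GammaR ∨ Q ∈ GammaL := by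
  obtain ⟨lam, sheet, him⟩ := Q
  cases sheet <;> rcases lt_or_gt_of_ne him with h | h <;> simp [GammaR, GammaL, h]

end DiracWeyl

theorem lemma4p5 (ψ : C(ℝ, ℂ)) (z : ℝ) (Q : DiracWeyl.Cover)
    (hfin : DiracWeyl.WeylFinite ψ z Q) :
    (∀ᶠ h : ℝ →ᵇ ℂ in 𝓝 0,
      ∃! e : ℝ → Fin 2 → ℂ, DiracWeyl.IsWeylSolution (ψ + h.toContinuousMap) z Q e) ∧
    (Q ∈ DiracWeyl.GammaR →
      DiracWeyl.HasFunctionalGradients (fun φ => DiracWeyl.weylFunction φ z Q) ψ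
        (fun y => if z ≤ y then -(DiracWeyl.weylSolution ψ y z Q 0) ^ 2 else 0)
        (fun y => if z ≤ y then (DiracWeyl.weylSolution ψ y z Q 1) ^ 2 else 0)) ∧
    (Q ∈ DiracWeyl.GammaL →
      DiracWeyl.HasFunctionalGradients (fun φ => DiracWeyl.weylFunction φ z Q) ψ
        (fun y => if y ≤ z then (DiracWeyl.weylSolution ψ y z Q 0) ^ 2 else 0)
        (fun y => if y ≤ z then -(DiracWeyl.weylSolution ψ y z Q 1) ^ 2 else 0)) := by
  rcases DiracWeyl.mem_gammaR_or_mem_gammaL Q with hR | hL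
  · obtain ⟨h1, h2⟩ := DiracWeyl.hasFunctionalGradients_weylFunction (S := Ici z) (s := 1)
      (Or.inl ⟨rfl, rfl⟩) (fun φ f hf => hf.2.1 hR) hfin
    refine ⟨h1, fun _ => ?_, fun hL => absurd hL (DiracWeyl.notMem_gammaL hR)⟩
    convert h2 using 3 <;> simp
  · obtain ⟨h1, h2⟩ := DiracWeyl.hasFunctionalGradients_weylFunction (S := Iic z) (s := -1)
      (Or.inr ⟨rfl, rfl⟩) (fun φ f hf => hf.2.2 hL) hfin
    refine ⟨h1, fun hR => absurd hL (DiracWeyl.notMem_gammaL hR), fun _ => ?_⟩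
    convert h2 using 3 <;> simp
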